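/- **Setting.** Let $n\ge 2$, $p\ge 1$, $m\ge 1$ and $s,K\ge 0$ be integers. Let $L_k=\sqrt{2k+1}\,P_k$ be the Legendre polynomials normalized in $L^2([-1,1],\tfrac12dx)$, and for a multi-index $\alpha\in\mathbb N^n$ with $|\alpha|\le p$ put $\Phi_\alpha(x)=\prod_{i=1}^n L_{\alpha_i}(x_i)$; there are $N=\binom{n+p}{p}$ of them. Consider an evolution equation $\dot u=f(u)$ in $\mathbb R^n$ that satisfies the cyclic condition $f_j(x_1,\dots,x_n)=f_i(x_{j-i+1},\dots,x_{j-i+n})$ for all $i,j$ (indices modulo $n$), and suppose that each component is $f_j=\sum_{|\alpha|\le p}C_{j,\alpha}\Phi_\alpha$ with at most $s$ non-zero coefficients. Let $c=(C_{1,\alpha})_\alpha\in\mathbb R^N$ be the coefficient vector of $f_1$. For states $x^{(1)},\dots,x^{(Q)}\in\mathbb R^n$, the dictionary $A_L$ is the $nQ\times N$ matrix with entries $\Phi_\alpha(x^{(q)}_j,x^{(q)}_{j+1},\dots,x^{(q)}_{j+n-1})$ in row $(q,j)$, $1\le q\le Q$, $1\le j\le n$, and column $\alpha$ (indices modulo $n$).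 For a vector $V$ of corresponding velocities and $\sigma\ge 0$, the Legendre basis pursuit problem is $$\min_{c'\in\mathbb R^N}\|c'\|_1\quad\text{subject to}\quad\|A_Lc'-V\|_2\le\sigma.\tag{L-BP$_\sigma$}$$ **Theorem.** There is a universal constant $d>0$ with the following property. In the setting above, let $u(\cdot\,;1),\dots,u(\cdot\,;K)$ be random trajectories (bursts) that almost surely solve $\dot u=f(u)$ on a time interval starting at $t_0$ and containing the times $t_0<t_1<\dots<t_{m-1}$ (with a larger right endpoint). Assume that the initial data are i.i.d. uniform on $[-1,1]^n$, i.e. all components $u_i(t_0;k)$, $1\le i\le n$, $1\le k\le K$, are independent and uniform on $[-1,1]$, and that $$K\ \ge\ \frac{144\,p^6\,9^p\,s^2\,\log n}{n}.$$ Then with probability exceeding $$1-\Big(\frac ep+\frac e{2p^2}\Big)^{2p}n^{-2p/11}$$ both of the following hold. 1. If $A_L$ and $V$ are built from all the states $u(t_i;k)$ and the exact velocities $\dot u(t_i;k)$, $0\le i\le m-1$, $1\le k\le K$, then $c$ is the unique solution of (L-BP$_0$). 2. For every $\eta$ and all approximations $\widetilde{\dot u}(t_0;k)\in\mathbb R^n$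 of the initial velocities with $$\sqrt{\frac1K\sum_{k=1}^K\big|\widetilde{\dot u}(t_0;k)-\dot u(t_0;k)\big|^2}\ \le\ \eta,$$ if $A_L$ is built from the initial states $u(t_0;k)$ only, $V$ from $\widetilde{\dot u}(t_0;k)$, and $\sigma=\sqrt K\,\eta$, then (L-BP$_\sigma$) has a minimizer, and every minimizer $c^\#$ satisfies $$\|c-c^\#\|_1\ \le\ d\,s\,\sigma.$$ -/

import Mathlib

open MeasureTheory ProbabilityTheory

noncomputable section

namespace CyclicRecovery

/-- The Legendre polynomial of degree `k` on `[-1,1]` (Rodrigues' formula), with value `1` at `1`: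
`P_k = (2^k k!)⁻¹ (d/dX)^k (X² - 1)^k`. -/
def legendrePoly (k : ℕ) : Polynomial ℝ :=
  Polynomial.C (((2 : ℝ) ^ k * (Nat.factorial k : ℝ))⁻¹) *
    (Polynomial.derivative^[k]) ((Polynomial.X ^ 2 - 1) ^ k)

/-- The univariate Legendre polynomial normalized in `L²([-1,1], dx/2)`. -/
def legendre (k : ℕ) (x : ℝ) : ℝ :=
  Real.sqrt (2 * (k : ℝ) + 1) * (legendrePoly k).eval x

/-- Multi-indices in `n` variables of total degree at most `p`
(every exponent is then at most `p`). They index the columns of the dictionary. -/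
abbrev MultiIndex (n p : ℕ) : Type :=
  {α : Fin n → Fin (p + 1) // ∑ i, (α i : ℕ) ≤ p}

/-- The tensorized Legendre basis function `∏ i, L_{α i}(x i)`. -/
def tensorLegendre {n p : ℕ} (α : MultiIndex n p) (x : Fin n → ℝ) : ℝ :=
  ∏ i, legendre (α.1 i : ℕ) (x i)

/-- The cyclic shift `(x_j, x_{j+1}, …, x_{j-1})` of `x` (indices modulo `n`). -/
def cyclicShift {n : ℕ} (j : Fin n) (x : Fin n → ℝ) : Fin n → ℝ :=
  fun l => x (j + l)

/-- The cyclic structural condition: `f_j(x_1, …, x_n) = f_i(x_{j-i+1}, …, x_{j-i+n})` for all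
`i, j`, with indices modulo `n`. -/
def IsCyclic {n : ℕ} (f : (Fin n → ℝ) → Fin n → ℝ) : Prop :=
  ∀ (i j : Fin n) (x : Fin n → ℝ), f x j = f (cyclicShift (j - i) x) i

/-- `u` solves `u' = f(u)` on the time interval `[t₀, T)`; the derivative at `t₀` is the
right derivative, at later times it is the two-sided derivative. -/
def IsSolutionOn {n : ℕ} (f : (Fin n → ℝ) → Fin n → ℝ) (t₀ T : ℝ) (u : ℝ → Fin n → ℝ) : Prop :=
  ∀ τ ∈ Set.Ico t₀ T, HasDerivWithinAt u (f (u τ)) (Set.Ici t₀) τ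

/-- The velocity at time `τ` of a trajectory starting at time `t₀`. -/
def velocity {n : ℕ} (t₀ : ℝ) (u : ℝ → Fin n → ℝ) (τ : ℝ) : Fin n → ℝ :=
  derivWithin u (Set.Ici t₀) τ

/-- The cyclic Legendre dictionary of order `p` built from states `x q`, `q : Q`:
the rows `(q, 1), …, (q, n)` are the basis functions evaluated at the `n` cyclic shifts
of `x q`. -/
def dictionary {Q : Type*} {n : ℕ} (p : ℕ) (x : Q → Fin n → ℝ) :
    Matrix (Q × Fin n) (MultiIndex n p) ℝ :=
  Matrix.of fun r α => tensorLegendre α (cyclicShift r.2 (x r.1))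

/-- The `ℓ¹` norm of a vector. -/
def l1Norm {ι : Type*} [Fintype ι] (c : ι → ℝ) : ℝ := ∑ i, |c i|

/-- The `ℓ²` norm of a vector. -/
def l2Norm {ι : Type*} [Fintype ι] (v : ι → ℝ) : ℝ := Real.sqrt (∑ i, v i ^ 2)

/-- `c` has at most `s` non-zero entries. -/
def IsSparse {ι : Type*} (s : ℕ) (c : ι → ℝ) : Prop :=
  (Function.support c).encard ≤ s

/-- Feasibility for the basis pursuit problem: `‖A c' - V‖₂ ≤ σ`. -/
def IsFeasible {R ι : Type*} [Fintype R] [Fintype ι] (A : Matrix R ι ℝ) (V : R → ℝ) (σ : ℝ)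
    (c : ι → ℝ) : Prop :=
  l2Norm (A.mulVec c - V) ≤ σ

/-- `c` is a solution (a minimizer) of: minimize `‖c'‖₁` subject to `‖A c' - V‖₂ ≤ σ`. -/
def IsBPMinimizer {R ι : Type*} [Fintype R] [Fintype ι] (A : Matrix R ι ℝ) (V : R → ℝ) (σ : ℝ)
    (c : ι → ℝ) : Prop :=
  IsFeasible A V σ c ∧ ∀ c' : ι → ℝ, IsFeasible A V σ c' → l1Norm c ≤ l1Norm c'

end CyclicRecovery

end

/-!
The vector `c` is recovered because, at the initial times alone, the dictionary `A` has a Gram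
matrix `AᵀA` entrywise close to `K n` times the identity: within `9 K n / (20 s)`, except with the
stated small probability.

Given this, the recovery is deterministic. If `c'` is no larger than `c` in `ℓ¹`, then the error
`h = c - c'` has at least half of its `ℓ¹` norm on the support of `c`
(`l1Norm_sub_le_two_mul_sum`), while comparing `AᵀA h` with `K n h` bounds each `|h i|` by a multiple
of `‖A h‖₂` plus `9 / (20 s) ‖h‖₁` (`abs_le_of_nearly_orthogonal`). Summing over the at most `s`
elements of the support and absorbing gives `‖h‖₁ ≤ 30 s ‖A h‖₂`
(`l1Norm_sub_le_of_nearly_orthogonal`). For noisy data `‖A h‖₂ ≤ 2 σ`, which gives `d = 60`. For exact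
data at all times `A h = 0` already on the initial rows, so `h = 0`. By the cyclic condition the
vector of velocities is `A c` (`dictionary_mulVec_eq`).

For the probability, an entry of `AᵀA` is a sum of `Φ_α Φ_β` over all `n` cyclic shifts of the `K`
independent samples. The mean is `K n` times the Kronecker delta by orthonormality of the Legendre
system, and each summand is bounded by `3^p` since `|L_k| ≤ √3 ^ k` on `[-1,1]`. The summands for
different shifts are dependent, but `Φ_α Φ_β` involves only a set `U` of at most `2p` coordinates.
A maximal set `I` of shifts with disjoint translates of `U` has at least `n / (4 p²)` elements, the
sum over all shifts is the average of the sums over the translates of `I`, and each of these is a sum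
of independent terms. This yields Hoeffding's inequality with the number of samples reduced by a factor
`4 p²` (`measureReal_abs_sum_shift_ge_le`). With the assumed size of `K`, an entry fails with
probability at most `2 n ^ (-3.645 p⁴)`, and a union bound over the at most `(n + 1) ^ (2p)` entries
suffices (`measureReal_badStates_lt`).
-/

noncomputable section

namespace CyclicRecovery

/-! ### Legendre polynomials -/

section Legendre

open Polynomial

lemma eval_iterate_derivative_sq_sub_one_pow {k i : ℕ} (hi : i < k) {a : ℝ} (ha : a ^ 2 = 1) :
    (derivative^[i] ((X ^ 2 - 1 : ℝ[X]) ^ k)).eval a = 0 := by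
  obtain ⟨r, hr⟩ := pow_sub_dvd_iterate_derivative_pow (X ^ 2 - 1 : ℝ[X]) k i
  rw [hr]
  simp [ha, Nat.sub_ne_zero_of_lt hi]

lemma integral_eval_derivative (q : ℝ[X]) (a b : ℝ) :
    ∫ x in a..b, (derivative q).eval x = q.eval b - q.eval a :=
  intervalIntegral.integral_eq_sub_of_hasDerivAt (fun x _ => q.hasDerivAt x)
    ((derivative q).continuous.intervalIntegrable _ _)

lemma integral_derivative_mul (p q : ℝ[X]) (a b : ℝ) :
    ∫ x in a..b, (derivative p * q).eval x =
      (p * q).eval b - (p * q).eval a - ∫ x in a..b, (p * derivative q).eval x := by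
  rw [← integral_eval_derivative, ← intervalIntegral.integral_sub
    ((Polynomial.continuous _).intervalIntegrable _ _)
    ((Polynomial.continuous _).intervalIntegrable _ _)]
  simp [derivative_mul]

/-- Integration by parts `i` times; the boundary terms vanish because `±1` are roots of
multiplicity `k` of `(X² - 1)^k`. -/
lemma integral_iterate_derivative_mul_eq_zero {k i : ℕ} (hi : i ≤ k) (q : ℝ[X])
    (hq : derivative^[i] q = 0) :
    ∫ x in (-1 : ℝ)..1, (derivative^[i] ((X ^ 2 - 1 : ℝ[X]) ^ k) * q).eval x = 0 := by
  induction i generalizing q with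
  | zero =>
    have : q = 0 := by simpa using hq
    simp [this]
  | succ i ih =>
    rw [Function.iterate_succ_apply', integral_derivative_mul,
      ih (by omega) _ (by simpa [Function.iterate_succ_apply] using hq), eval_mul, eval_mul,
      eval_iterate_derivative_sq_sub_one_pow (by omega) (by norm_num),
      eval_iterate_derivative_sq_sub_one_pow (by omega) (by norm_num)]
    simp

lemma integral_legendrePoly_mul_eq_zero {k : ℕ} (q : ℝ[X]) (hq : derivative^[k] q = 0) :
    ∫ x in (-1 : ℝ)..1, (legendrePoly k * q).eval x = 0 := by
  have := integral_iterate_derivative_mul_eq_zero (le_refl k) q hq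
  simp only [legendrePoly, mul_assoc, eval_C_mul] at this ⊢
  rw [intervalIntegral.integral_const_mul, this, mul_zero]

lemma natDegree_legendrePoly_le (k : ℕ) : (legendrePoly k).natDegree ≤ k := by
  refine (natDegree_C_mul_le _ _).trans ((natDegree_iterate_derivative _ _).trans ?_)
  have h1 : ((X : ℝ[X]) ^ 2 - 1).natDegree = 2 := by
    rw [← C_1, natDegree_X_pow_sub_C]
  rw [natDegree_pow, h1]
  omega

lemma legendrePoly_eval_one_sq (k : ℕ) {a : ℝ} (ha : a ^ 2 = 1) :
    ((legendrePoly k).eval a) ^ 2 = 1 := by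
  have h := aeval_iterate_derivative_self ((X ^ 2 - 1 : ℝ[X]) ^ k) k a
    (p' := (X + C a) ^ k) (by
      rw [Algebra.algebraMap_self, map_id, ← mul_pow]
      congr 1
      have : (C a : ℝ[X]) * C a = 1 := by rw [← C_mul, ← sq, ha, C_1]
      linear_combination this)
  simp only [coe_aeval_eq_eval, nsmul_eq_mul, eval_pow, eval_add, eval_X, eval_C] at h
  rw [legendrePoly, eval_C_mul, h]
  have h2 : (a + a) ^ k * (a + a) ^ k = 2 ^ k * 2 ^ k := by
    rw [← mul_pow, ← mul_pow]
    congr 1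
    linear_combination 4 * ha
  have h3 : (k.factorial : ℝ) ≠ 0 := by positivity
  field_simp
  linear_combination h2

lemma iterate_derivative_X_mul_succ (p : ℝ[X]) (m : ℕ) :
    derivative^[m + 1] (X * p) =
      X * derivative^[m + 1] p + ((m : ℝ[X]) + 1) * derivative^[m] p := by
  rw [mul_comm X p, iterate_derivative_mul_X]
  simp [nsmul_eq_mul]
  ring

/-- The Legendre differential equation `(x² - 1) P'' + 2 x P' = k (k + 1) P`. -/
lemma legendrePoly_ode (k : ℕ) :
    (X ^ 2 - 1) * derivative (derivative (legendrePoly k)) + 2 * X * derivative (legendrePoly k) =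
      C ((k : ℝ) * (k + 1)) * legendrePoly k := by
  set w : ℝ[X] := (X ^ 2 - 1) ^ k with hw
  have h0 : (X ^ 2 - 1) * derivative w = 2 * (k : ℝ[X]) * (X * w) := by
    rcases k with _ | k
    · simp [hw]
    · simp only [hw, derivative_pow, derivative_sub, derivative_X, derivative_one, C_ofNat,
        Nat.cast_ofNat, C_eq_natCast]
      simp
      ring
  have h1 : X * (X * derivative w) = derivative w + (2 * (k : ℝ[X])) * (X * w) := by
    linear_combination h0
  have h2 := congrArg (derivative^[k + 1]) h1
  have e : (2 * (k : ℝ[X])) = ((2 * k : ℕ) : ℝ[X]) := by push_cast; ring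
  have key : (X ^ 2 - 1) * derivative (derivative (derivative^[k] w))
      + 2 * X * derivative (derivative^[k] w) = (k : ℝ[X]) * ((k : ℝ[X]) + 1) * derivative^[k] w := by
    rw [iterate_map_add, e, iterate_derivative_natCast_mul, iterate_derivative_X_mul_succ,
      iterate_derivative_X_mul_succ, iterate_derivative_X_mul_succ] at h2
    have h3 : derivative^[k] (X * derivative w) =
        X * derivative^[k] (derivative w) + (k : ℝ[X]) * derivative^[k] w := by
      rcases k with _ | k
      · simp
      · rw [iterate_derivative_X_mul_succ]
        simp [Function.iterate_succ_apply]
    rw [h3] at h2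
    simp only [← Function.iterate_succ_apply] at h2
    simp only [Function.iterate_succ_apply'] at h2
    push_cast at h2
    linear_combination h2
  rw [legendrePoly, ← hw, derivative_C_mul, derivative_C_mul]
  simp only [C_mul, C_add, C_1, C_eq_natCast]
  linear_combination C ((2 ^ k * (k.factorial : ℝ))⁻¹) * key

/-- The derivative of `k (k + 1) P² + (1 - x²) P'²` is `2 x P'²` by the Legendre equation, so this
function is largest at the end points, where it equals `k (k + 1)`. -/
lemma abs_legendrePoly_eval_le_one (k : ℕ) {x : ℝ} (hx : x ∈ Set.Icc (-1 : ℝ) 1) :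
    |(legendrePoly k).eval x| ≤ 1 := by
  rcases Nat.eq_zero_or_pos k with rfl | hk
  · simp [legendrePoly]
  set P := legendrePoly k with hP
  set F : ℝ[X] := C ((k : ℝ) * (k + 1)) * P ^ 2 + (1 - X ^ 2) * derivative P ^ 2 with hF
  have hF' : derivative F = 2 * X * derivative P ^ 2 := by
    have hode := legendrePoly_ode k
    rw [← hP] at hode
    simp only [hF, derivative_add, derivative_mul, derivative_C, derivative_one,
      derivative_pow, derivative_sub, derivative_X]
    simp only [C_ofNat, Nat.cast_ofNat]
    simp only [C_mul, C_add, C_1, C_eq_natCast] at hode ⊢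
    simp
    linear_combination (-2 * derivative P) * hode
  have hend : ∀ a : ℝ, a ^ 2 = 1 → F.eval a = k * (k + 1) := by
    intro a ha
    simp [hF, ha, legendrePoly_eval_one_sq k ha, P]
  have hder : ∀ y : ℝ, deriv (fun y => F.eval y) y = 2 * y * (derivative P).eval y ^ 2 := by
    intro y
    rw [Polynomial.deriv, hF']
    simp
  have hle : F.eval x ≤ k * (k + 1) := by
    rcases le_total 0 x with h | h
    · rw [← hend 1 (by norm_num)]
      have hm : MonotoneOn (fun y => F.eval y) (Set.Icc 0 1) := by
        refine monotoneOn_of_deriv_nonneg (convex_Icc _ _) F.continuous.continuousOn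
          F.differentiable.differentiableOn fun y hy => ?_
        rw [interior_Icc] at hy
        rw [hder]
        have := hy.1.le
        positivity
      exact hm ⟨h, hx.2⟩ (by simp) hx.2
    · rw [← hend (-1) (by norm_num)]
      have hm : AntitoneOn (fun y => F.eval y) (Set.Icc (-1) 0) := by
        refine antitoneOn_of_deriv_nonpos (convex_Icc _ _) F.continuous.continuousOn
          F.differentiable.differentiableOn fun y hy => ?_
        rw [interior_Icc] at hy
        rw [hder]
        have := hy.2.le
        exact mul_nonpos_of_nonpos_of_nonneg (by linarith) (sq_nonneg _)
      exact hm (by simp) ⟨hx.1, h⟩ hx.1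
  have hk' : (0 : ℝ) < k * (k + 1) := by positivity
  have h1 : (k : ℝ) * (k + 1) * P.eval x ^ 2 ≤ F.eval x := by
    have : 0 ≤ (1 - x ^ 2) * (derivative P).eval x ^ 2 :=
      mul_nonneg (by nlinarith [hx.1, hx.2]) (sq_nonneg _)
    simp only [hF, eval_add, eval_mul, eval_C, eval_pow, eval_sub, eval_one, eval_X]
    linarith
  rw [← sq_le_one_iff_abs_le_one]
  by_contra hcon
  nlinarith [mul_lt_mul_of_pos_left (not_le.mp hcon) hk']

/-- The norm of `P_k` follows from integrating `(x P_k²)' = P_k² + 2 x P_k P_k'`, because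
`x P_k' - k P_k` has degree less than `k` and is therefore orthogonal to `P_k`. -/
lemma integral_legendrePoly_mul_self (k : ℕ) :
    (2 * (k : ℝ) + 1) * ∫ x in (-1 : ℝ)..1, (legendrePoly k * legendrePoly k).eval x = 2 := by
  set P := legendrePoly k with hP
  set q := X * derivative P - (k : ℝ[X]) * P with hq
  have hq0 : derivative^[k] q = 0 := by
    have hd : derivative^[k + 1] P = 0 :=
      iterate_derivative_eq_zero (Nat.lt_succ_of_le (natDegree_legendrePoly_le k))
    rw [hq, iterate_derivative_sub, iterate_derivative_natCast_mul]
    rcases k with _ | k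
    · have hd' : derivative P = 0 := by simpa using hd
      simp [hd']
    · rw [iterate_derivative_X_mul_succ, ← Function.iterate_succ_apply,
        ← Function.iterate_succ_apply, hd]
      simp
  have h1 := integral_legendrePoly_mul_eq_zero q hq0
  have h2 := integral_eval_derivative (X * P * P) (-1) 1
  have e1 : derivative (X * P * P) = (2 * (k : ℝ[X]) + 1) * (P * P) + 2 * (P * q) := by
    simp only [derivative_mul, derivative_X, hq]
    ring
  have e2 : ∀ x : ℝ, (derivative (X * P * P)).eval x =
      (2 * (k : ℝ) + 1) * (P * P).eval x + 2 * (P * q).eval x := by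
    intro x; rw [e1]; simp
  simp_rw [e2] at h2
  rw [intervalIntegral.integral_add ((by fun_prop : Continuous _).intervalIntegrable _ _)
    ((by fun_prop : Continuous _).intervalIntegrable _ _), intervalIntegral.integral_const_mul,
    intervalIntegral.integral_const_mul, h1] at h2
  have h3 := legendrePoly_eval_one_sq k (a := 1) (by norm_num)
  have h4 := legendrePoly_eval_one_sq k (a := -1) (by norm_num)
  simp only [eval_mul, eval_X] at h2 ⊢
  rw [← hP] at h3 h4
  linear_combination h2 + h3 + h4

lemma legendre_zero (x : ℝ) : legendre 0 x = 1 := by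
  simp [legendre, legendrePoly]

@[fun_prop]
lemma continuous_legendre (k : ℕ) : Continuous (legendre k) := by
  unfold legendre
  fun_prop

lemma abs_legendre_le (k : ℕ) {x : ℝ} (hx : x ∈ Set.Icc (-1 : ℝ) 1) :
    |legendre k x| ≤ √3 ^ k := by
  rw [legendre, abs_mul, abs_of_nonneg (Real.sqrt_nonneg _)]
  refine (mul_le_of_le_one_right (Real.sqrt_nonneg _) (abs_legendrePoly_eval_le_one k hx)).trans ?_
  rw [Real.sqrt_le_iff]
  refine ⟨by positivity, ?_⟩
  rw [← pow_mul, mul_comm k, pow_mul, Real.sq_sqrt (by norm_num)]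
  have := one_add_mul_le_pow (a := (2 : ℝ)) (by norm_num) k
  norm_num at this
  linarith

/-- Orthonormality of the normalized Legendre polynomials in `L²([-1,1], dx/2)`. -/
lemma integral_legendre_mul (j k : ℕ) :
    ∫ x in (-1 : ℝ)..1, legendre j x * legendre k x = if j = k then 2 else 0 := by
  have e : ∀ x : ℝ, legendre j x * legendre k x =
      (√(2 * j + 1) * √(2 * k + 1)) * (legendrePoly j * legendrePoly k).eval x := by
    intro x; simp [legendre]; ring
  simp_rw [e]
  rw [intervalIntegral.integral_const_mul]
  split_ifs with h
  · subst h
    rw [Real.mul_self_sqrt (by positivity), integral_legendrePoly_mul_self]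
  · rcases lt_or_gt_of_ne h with h | h
    · rw [mul_comm (legendrePoly j), integral_legendrePoly_mul_eq_zero, mul_zero]
      exact iterate_derivative_eq_zero ((natDegree_legendrePoly_le j).trans_lt h)
    · rw [integral_legendrePoly_mul_eq_zero, mul_zero]
      exact iterate_derivative_eq_zero ((natDegree_legendrePoly_le k).trans_lt h)

end Legendre

/-! ### Basis pursuit with a nearly orthogonal dictionary -/

section BasisPursuit

variable {R ι : Type*} [Fintype R] [Fintype ι]

lemma l1Norm_nonneg (c : ι → ℝ) : 0 ≤ l1Norm c := Finset.sum_nonneg fun _ _ => abs_nonneg _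

lemma l2Norm_nonneg (v : ι → ℝ) : 0 ≤ l2Norm v := Real.sqrt_nonneg _

lemma l2Norm_sq (v : ι → ℝ) : l2Norm v ^ 2 = ∑ i, v i ^ 2 :=
  Real.sq_sqrt (Finset.sum_nonneg fun _ _ => sq_nonneg _)

lemma l2Norm_eq_norm (v : ι → ℝ) : l2Norm v = ‖WithLp.toLp 2 v‖ := by
  simp [l2Norm, EuclideanSpace.norm_eq]

lemma l2Norm_sub_le (v w : ι → ℝ) : l2Norm (v - w) ≤ l2Norm v + l2Norm w := by
  simp only [l2Norm_eq_norm, WithLp.toLp_sub]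
  exact norm_sub_le _ _

lemma l2Norm_sub_comm (v w : ι → ℝ) : l2Norm (v - w) = l2Norm (w - v) := by
  simp only [l2Norm_eq_norm, WithLp.toLp_sub]
  exact norm_sub_rev _ _

lemma l2Norm_eq_zero {v : ι → ℝ} (h : l2Norm v ≤ 0) : v = 0 := by
  rw [l2Norm_eq_norm, norm_le_zero_iff] at h
  exact (WithLp.toLp_eq_zero 2).mp h

lemma eq_zero_of_l1Norm_le_zero {c : ι → ℝ} (h : l1Norm c ≤ 0) : c = 0 := by
  funext i
  have h1 := (Finset.sum_eq_zero_iff_of_nonneg fun i _ => abs_nonneg (c i)).mp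
    (le_antisymm h (l1Norm_nonneg c)) i (Finset.mem_univ i)
  simpa using h1

lemma abs_sum_mul_le_l2Norm (v w : ι → ℝ) : |∑ i, v i * w i| ≤ l2Norm v * l2Norm w := by
  refine abs_le_of_sq_le_sq ?_ (mul_nonneg (l2Norm_nonneg _) (l2Norm_nonneg _))
  rw [mul_pow, l2Norm_sq, l2Norm_sq]
  exact Finset.sum_mul_sq_le_sq_mul_sq _ _ _

/-- The cone condition: if `c'` is no larger than `c` in `ℓ¹`, then half of the `ℓ¹` norm of the
error sits on the support of `c`. -/
lemma l1Norm_sub_le_two_mul_sum {c c' : ι → ℝ} (hle : l1Norm c' ≤ l1Norm c) {S : Finset ι}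
    (hS : ∀ i ∉ S, c i = 0) : l1Norm (c - c') ≤ 2 * ∑ i ∈ S, |c i - c' i| := by
  classical
  have h : ∀ i, |(c - c') i| ≤ (if i ∈ S then 2 * |c i - c' i| else 0) + (|c' i| - |c i|) := by
    intro i
    rw [Pi.sub_apply]
    split_ifs with hi
    · linarith [abs_sub_abs_le_abs_sub (c i) (c' i)]
    · simp [hS i hi]
  have h2 := Finset.sum_le_sum fun i (_ : i ∈ Finset.univ) => h i
  rw [Finset.sum_add_distrib, Finset.sum_sub_distrib, Finset.sum_ite_mem, Finset.univ_inter,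
    ← Finset.mul_sum] at h2
  unfold l1Norm at hle ⊢
  linarith

/-- Each coordinate of `h` is controlled by the image `A h` and by a `1/s` fraction of `‖h‖₁`,
by comparing `AᵀA h` with `M h`. -/
lemma abs_le_of_nearly_orthogonal [DecidableEq ι] (A : Matrix R ι ℝ) {M : ℝ} {s : ℕ} (hs : s ≠ 0)
    (hM : 1 ≤ M)
    (hG : ∀ i j, s * |∑ r, A r i * A r j - if i = j then M else 0| ≤ 9 / 20 * M)
    (h : ι → ℝ) (i : ι) :
    s * |h i| ≤ 3 / 2 * s * l2Norm (A.mulVec h) + 9 / 20 * l1Norm h := by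
  have hs1 : (1 : ℝ) ≤ s := by exact_mod_cast Nat.one_le_iff_ne_zero.mpr hs
  have hid : M * h i = ∑ r, A r i * A.mulVec h r -
      ∑ j, (∑ r, A r i * A r j - if i = j then M else 0) * h j := by
    simp only [sub_mul, Finset.sum_sub_distrib, ite_mul, zero_mul, Finset.sum_ite_eq,
      Finset.mem_univ, if_true, Matrix.mulVec, dotProduct, Finset.mul_sum, Finset.sum_mul]
    rw [Finset.sum_comm]
    simp only [mul_assoc]
    ring
  have hcol : l2Norm (fun r => A r i) ≤ 3 / 2 * M := by
    rw [l2Norm, Real.sqrt_le_iff]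
    refine ⟨by positivity, ?_⟩
    have h1 := hG i i
    simp only [if_true, ← sq] at h1
    have h2 := le_abs_self (∑ r, A r i ^ 2 - M)
    nlinarith [abs_nonneg (∑ r, A r i ^ 2 - M)]
  have h1 : |∑ r, A r i * A.mulVec h r| ≤ 3 / 2 * M * l2Norm (A.mulVec h) :=
    (abs_sum_mul_le_l2Norm (fun r => A r i) (A.mulVec h)).trans
      (mul_le_mul_of_nonneg_right hcol (l2Norm_nonneg _))
  have h2 : s * |∑ j, (∑ r, A r i * A r j - if i = j then M else 0) * h j| ≤
      9 / 20 * M * l1Norm h := by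
    rw [l1Norm, Finset.mul_sum]
    refine (mul_le_mul_of_nonneg_left (Finset.abs_sum_le_sum_abs _ _) (by positivity)).trans ?_
    rw [Finset.mul_sum]
    refine Finset.sum_le_sum fun j _ => ?_
    rw [abs_mul, ← mul_assoc]
    exact mul_le_mul_of_nonneg_right (hG i j) (abs_nonneg _)
  have h3 : M * (s * |h i|) ≤
      M * (3 / 2 * s * l2Norm (A.mulVec h) + 9 / 20 * l1Norm h) := by
    have h4 : M * |h i| ≤ |∑ r, A r i * A.mulVec h r| +
        |∑ j, (∑ r, A r i * A r j - if i = j then M else 0) * h j| := by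
      rw [← abs_of_nonneg (by linarith : (0 : ℝ) ≤ M), ← abs_mul, hid,
        abs_of_nonneg (by linarith : (0 : ℝ) ≤ M)]
      exact abs_sub _ _
    nlinarith
  exact le_of_mul_le_mul_left h3 (by linarith)

/-- Sparse recovery for a nearly orthogonal dictionary: the Gram matrix `AᵀA` is entrywise
within `9 M / (20 s)` of `M` times the identity. For `s = 0` this says nothing, and the cone
condition alone gives the bound. -/
lemma l1Norm_sub_le_of_nearly_orthogonal [DecidableEq ι] (A : Matrix R ι ℝ) {M : ℝ} {s : ℕ}
    (hM : s ≠ 0 → 1 ≤ M)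
    (hG : ∀ i j, s * |∑ r, A r i * A r j - if i = j then M else 0| ≤ 9 / 20 * M)
    {c c' : ι → ℝ} (hc : IsSparse s c) (hle : l1Norm c' ≤ l1Norm c) :
    l1Norm (c - c') ≤ 30 * s * l2Norm (A.mulVec (c - c')) := by
  have hfin : (Function.support c).Finite := Set.toFinite _
  have hcard : hfin.toFinset.card ≤ s := by
    have := hc
    rw [IsSparse, hfin.encard_eq_coe_toFinset_card] at this
    exact_mod_cast this
  have hcone := l1Norm_sub_le_two_mul_sum hle (S := hfin.toFinset) (by simp)
  rcases eq_or_ne s 0 with rfl | hs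
  · have : hfin.toFinset = ∅ := Finset.card_eq_zero.mp (Nat.le_zero.mp hcard)
    rw [this] at hcone
    simpa using hcone
  have hs1 : (0 : ℝ) < s := by exact_mod_cast Nat.pos_of_ne_zero hs
  have hpt := fun i => abs_le_of_nearly_orthogonal A hs (hM hs) hG (c - c') i
  set B := 3 / 2 * s * l2Norm (A.mulVec (c - c')) + 9 / 20 * l1Norm (c - c') with hB
  have hB0 : 0 ≤ B := by
    have := l2Norm_nonneg (A.mulVec (c - c'))
    have := l1Norm_nonneg (c - c')
    positivity
  have hsum : s * ∑ i ∈ hfin.toFinset, |c i - c' i| ≤ s * B := by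
    rw [Finset.mul_sum]
    refine (Finset.sum_le_sum fun i _ => hpt i).trans ?_
    rw [Finset.sum_const, nsmul_eq_mul]
    exact mul_le_mul_of_nonneg_right (by exact_mod_cast hcard) hB0
  have := le_of_mul_le_mul_left hsum hs1
  linarith

lemma continuous_l1Norm : Continuous (l1Norm : (ι → ℝ) → ℝ) := by
  unfold l1Norm
  fun_prop

lemma continuous_l2Norm : Continuous (l2Norm : (ι → ℝ) → ℝ) := by
  unfold l2Norm
  fun_prop

/-- Among the feasible points, those that are no larger in `ℓ¹` than a given one form a compact
set. -/
lemma exists_isBPMinimizer (A : Matrix R ι ℝ) (V : R → ℝ) (σ : ℝ) {c : ι → ℝ}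
    (hc : IsFeasible A V σ c) : ∃ c', IsBPMinimizer A V σ c' := by
  have hclosed : IsClosed {c' : ι → ℝ | IsFeasible A V σ c' ∧ l1Norm c' ≤ l1Norm c} := by
    refine IsClosed.inter ?_ ?_
    · refine isClosed_le (continuous_l2Norm.comp ?_) continuous_const
      exact (Continuous.matrix_mulVec continuous_const continuous_id).sub continuous_const
    · exact isClosed_le continuous_l1Norm continuous_const
  have hcomp : IsCompact {c' : ι → ℝ | IsFeasible A V σ c' ∧ l1Norm c' ≤ l1Norm c} := by
    refine (isCompact_closedBall (0 : ι → ℝ) (l1Norm c)).of_isClosed_subset hclosed ?_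
    rintro c' ⟨-, h⟩
    rw [mem_closedBall_zero_iff, pi_norm_le_iff_of_nonneg (l1Norm_nonneg c)]
    intro i
    rw [Real.norm_eq_abs]
    exact (Finset.single_le_sum (f := fun i => |c' i|) (fun i _ => abs_nonneg _)
      (Finset.mem_univ i)).trans h
  obtain ⟨c', hc', hmin⟩ := hcomp.exists_isMinOn ⟨c, hc, le_rfl⟩ continuous_l1Norm.continuousOn
  refine ⟨c', hc'.1, fun c'' h'' => ?_⟩
  rcases le_total (l1Norm c'') (l1Norm c) with h | h
  · exact hmin ⟨h'', h⟩
  · exact hc'.2.trans h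

end BasisPursuit

/-! ### Concentration for sums over the cyclic shifts -/

section Concentration

open scoped NNReal Pointwise

/-- A maximal set `I` of shifts with disjoint translates of `U`: every other shift meets one of
these translates, so it lies in `I + (U - U)`. -/
lemma exists_disjoint_translates {G : Type*} [Fintype G] [DecidableEq G] [AddCommGroup G]
    (U : Finset G) {D : ℕ} (hD : 1 ≤ D) (hU : U.card ^ 2 ≤ D) :
    ∃ I : Finset G, (I : Set G).PairwiseDisjoint (fun i => i +ᵥ U) ∧
      Fintype.card G ≤ I.card * D := by
  classical
  rcases U.eq_empty_or_nonempty with rfl | ⟨u₀, hu₀⟩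
  · refine ⟨Finset.univ, fun i _ j _ _ => by simp, ?_⟩
    rw [Finset.card_univ]
    exact Nat.le_mul_of_pos_right _ hD
  · obtain ⟨I, hI⟩ := (Finset.univ.filter fun I : Finset G =>
      (I : Set G).PairwiseDisjoint (fun i => i +ᵥ U)).exists_maximal ⟨∅, by simp⟩
    have hIdisj : (I : Set G).PairwiseDisjoint (fun i => i +ᵥ U) := by simpa using hI.prop
    refine ⟨I, hIdisj, ?_⟩
    have hcover : (Finset.univ : Finset G) ⊆ I + (U - U) := by
      intro x _
      by_contra hx
      have hxI : ∀ i ∈ I, Disjoint (x +ᵥ U) (i +ᵥ U) := by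
        intro i hi
        rw [Finset.disjoint_left]
        intro y hy hy'
        obtain ⟨u, hu, rfl⟩ := Finset.mem_vadd_finset.mp hy
        obtain ⟨v, hv, hvu⟩ := Finset.mem_vadd_finset.mp hy'
        refine hx (Finset.mem_add.mpr ⟨i, hi, v - u, Finset.sub_mem_sub hv hu, ?_⟩)
        simp only [vadd_eq_add] at hvu
        rw [← add_sub_assoc, hvu, add_sub_cancel_right]
      have hins : ((insert x I : Finset G) : Set G).PairwiseDisjoint (fun i => i +ᵥ U) := by
        rw [Finset.coe_insert]
        exact hIdisj.insert fun i hi _ => hxI i hi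
      have hle := hI.le_of_ge (y := insert x I) (by simpa using hins) (Finset.subset_insert _ _)
      have hxmem : x ∈ I := hle (Finset.mem_insert_self _ _)
      refine hx (Finset.mem_add.mpr ⟨x, hxmem, u₀ - u₀, Finset.sub_mem_sub hu₀ hu₀, by simp⟩)
    calc Fintype.card G = (Finset.univ : Finset G).card := rfl
      _ ≤ (I + (U - U)).card := Finset.card_le_card hcover
      _ ≤ I.card * (U - U).card := Finset.card_add_le
      _ ≤ I.card * (U.card * U.card) := Nat.mul_le_mul_left _ Finset.card_sub_le
      _ ≤ I.card * D := Nat.mul_le_mul_left _ (by rwa [← sq])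

lemma hasSubgaussianMGF_sum_const {Ω B : Type*} {mΩ : MeasurableSpace Ω} {μ : Measure Ω}
    [IsProbabilityMeasure μ] {Y : B → Ω → ℝ} {c : ℝ≥0} (s : Finset B)
    (h : ∀ b ∈ s, HasSubgaussianMGF (Y b) c μ) :
    HasSubgaussianMGF (fun ω => ∑ b ∈ s, Y b ω) ((s.card : ℝ≥0) ^ 2 * c) μ := by
  classical
  induction s using Finset.induction_on with
  | empty => simp
  | insert b s hb ih =>
    have h1 := (h b (Finset.mem_insert_self _ _)).add
      (ih fun b' hb' => h b' (Finset.mem_insert_of_mem hb'))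
    simp only [Finset.sum_insert hb]
    convert h1 using 1
    rw [NNReal.sqrt_mul, NNReal.sqrt_sq, Finset.card_insert_of_notMem hb]
    have := NNReal.sq_sqrt c
    push_cast
    calc ((s.card : ℝ≥0) + 1) ^ 2 * c = ((s.card : ℝ≥0) + 1) ^ 2 * NNReal.sqrt c ^ 2 := by rw [this]
      _ = _ := by ring

variable {κ : Type*} [Fintype κ]

/-- Functions of disjoint sets of coordinates are independent under a product measure. -/
lemma indepFun_of_dependsOn (ν : Measure ℝ) [IsProbabilityMeasure ν] {S T : Finset κ}
    (hST : Disjoint S T) {g h : (κ → ℝ) → ℝ} (hg : Measurable g) (hh : Measurable h)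
    (hgS : DependsOn g S) (hhT : DependsOn h T) :
    IndepFun g h (Measure.pi fun _ : κ => ν) := by
  classical
  have hi : iIndepFun (fun (i : κ) (x : κ → ℝ) => x i) (Measure.pi fun _ : κ => ν) :=
    iIndepFun_pi (X := fun _ y => y) fun _ => aemeasurable_id
  have h1 := hi.indepFun_finset S T hST fun i => measurable_pi_apply i
  let ext : (W : Finset κ) → (W → ℝ) → κ → ℝ := fun W y i => if hi : i ∈ W then y ⟨i, hi⟩ else 0
  have hext : ∀ W, Measurable (ext W) := by
    intro W
    refine measurable_pi_lambda _ fun i => ?_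
    by_cases hi : i ∈ W
    · simpa [ext, hi] using measurable_pi_apply _
    · simp [ext, hi]
  have h2 := h1.comp (hg.comp (hext S)) (hh.comp (hext T))
  convert h2 using 1
  · funext x
    exact hgS fun i hi => by simp [ext, Finset.mem_coe.mp hi]
  · funext x
    exact hhT fun i hi => by simp [ext, Finset.mem_coe.mp hi]

lemma hasSubgaussianMGF_sum_of_dependsOn {B : Type*} [DecidableEq κ] (ν : Measure ℝ)
    [IsProbabilityMeasure ν] {T : B → Finset κ} {Y : B → (κ → ℝ) → ℝ} {c : ℝ≥0} (s : Finset B)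
    (hT : (s : Set B).PairwiseDisjoint T) (hmeas : ∀ b, Measurable (Y b))
    (hdep : ∀ b, DependsOn (Y b) (T b))
    (h : ∀ b ∈ s, HasSubgaussianMGF (Y b) c (Measure.pi fun _ : κ => ν)) :
    HasSubgaussianMGF (fun x => ∑ b ∈ s, Y b x) (s.card * c) (Measure.pi fun _ : κ => ν) := by
  classical
  induction s using Finset.induction_on with
  | empty => simp
  | insert b s hb ih =>
    rw [Finset.coe_insert] at hT
    have hdisj : Disjoint (T b) (s.biUnion T) := by
      rw [Finset.disjoint_biUnion_right]
      intro b' hb'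
      exact hT (Set.mem_insert _ _) (Set.mem_insert_of_mem _ hb') (by rintro rfl; exact hb hb')
    have hdep' : DependsOn (fun x => ∑ b ∈ s, Y b x) (s.biUnion T) := by
      intro x y hxy
      refine Finset.sum_congr rfl fun b' hb' => hdep b' fun i hi => hxy i ?_
      exact Finset.mem_coe.mpr (Finset.mem_biUnion.mpr ⟨b', hb', hi⟩)
    have h1 := (h b (Finset.mem_insert_self _ _)).add_of_indepFun
      (ih (hT.subset (Set.subset_insert _ _)) fun b' hb' => h b' (Finset.mem_insert_of_mem hb'))
      (indepFun_of_dependsOn ν hdisj (hmeas b) (Finset.measurable_fun_sum _ fun b _ => hmeas b)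
        (hdep b) hdep')
    simp only [Finset.sum_insert hb]
    convert h1 using 1
    rw [Finset.card_insert_of_notMem hb]
    push_cast
    ring

/-- Hoeffding's inequality for the sum of a function `g` of few coordinates over all shifts of
`K` independent samples. The shifts are not independent, but the shifts in a set `I` with disjoint
translates of the support are, and the sum over all shifts is an average of the sums over the
translates of `I`; this costs the factor `D` in the exponent. -/
lemma measureReal_abs_sum_shift_ge_le {κ G : Type*} [Fintype κ] [Fintype G] [DecidableEq κ]
    [DecidableEq G] [AddCommGroup G] (ν : Measure ℝ) [IsProbabilityMeasure ν] {J : Set ℝ}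
    (hJ : ∀ᵐ y ∂ν, y ∈ J) {g : (G → ℝ) → ℝ} (hg : Measurable g) {U : Finset G}
    (hgU : DependsOn g U) {b m : ℝ} (hb : 0 < b) (hgb : ∀ z : G → ℝ, (∀ i, z i ∈ J) → |g z| ≤ b)
    (hm : ∀ (k : κ) (j : G),
      ∫ x : κ × G → ℝ, g (fun l => x (k, j + l)) ∂(Measure.pi fun _ => ν) = m)
    {D : ℕ} (hD : 1 ≤ D) (hU : U.card ^ 2 ≤ D) {ε : ℝ} (hε : 0 ≤ ε) :
    (Measure.pi fun _ : κ × G => ν).real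
        {x | ε ≤ |∑ q : κ × G, (g (fun l => x (q.1, q.2 + l)) - m)|} ≤
      2 * Real.exp (-ε ^ 2 / (2 * (Fintype.card κ * Fintype.card G * D * b ^ 2))) := by
  classical
  set μ := Measure.pi fun _ : κ × G => ν with hμ
  obtain ⟨I, hI, hcard⟩ := exists_disjoint_translates U hD hU
  set Z : κ × G → (κ × G → ℝ) → ℝ := fun q x => g (fun l => x (q.1, q.2 + l)) - m with hZ
  have hshift : ∀ q : κ × G, Measurable fun x : κ × G → ℝ => g (fun l => x (q.1, q.2 + l)) :=
    fun q => hg.comp (measurable_pi_lambda _ fun l => measurable_pi_apply _)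
  have hZm : ∀ q, Measurable (Z q) := fun q => (hshift q).sub_const m
  have hbd : ∀ᵐ x ∂μ, ∀ q, x q ∈ J := by
    rw [ae_all_iff]
    intro q
    exact (Measure.quasiMeasurePreserving_eval (fun _ : κ × G => ν) q).ae hJ
  set c : ℝ≥0 := b.toNNReal ^ 2 with hc
  have hbc : (c : ℝ) = b ^ 2 := by simp [hc, hb.le]
  have hZs : ∀ q, HasSubgaussianMGF (Z q) c μ := by
    intro q
    have h1 := hasSubgaussianMGF_of_mem_Icc (μ := μ) (a := -b) (b := b) (hshift q).aemeasurable
      (by filter_upwards [hbd] with x hx using abs_le.mp (hgb _ fun i => hx _))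
    rw [hm] at h1
    convert h1 using 2
    ext
    simp [abs_of_pos hb, ← two_mul, hb.le]
  -- the block of all `Z (k, a + i)` with `i ∈ I`
  have hblock : ∀ a : G, HasSubgaussianMGF
      (fun x => ∑ r ∈ (Finset.univ : Finset κ) ×ˢ I, Z (r.1, a + r.2) x)
      ((Fintype.card κ * I.card : ℕ) * c) μ := by
    intro a
    have := hasSubgaussianMGF_sum_of_dependsOn ν (Y := fun r : κ × G => Z (r.1, a + r.2))
      (T := fun r => {r.1} ×ˢ ((a + r.2) +ᵥ U)) (c := c) ((Finset.univ : Finset κ) ×ˢ I) ?_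
      (fun r => hZm _) ?_ (fun r _ => hZs _)
    · rwa [Finset.card_product, Finset.card_univ] at this
    · intro r hr r' hr' hne
      rw [Function.onFun, Finset.disjoint_product]
      by_cases h1 : r.1 = r'.1
      · right
        have h2 : r.2 ≠ r'.2 := fun h2 => hne (Prod.ext h1 h2)
        have h3 := hI (Finset.mem_coe.mpr (Finset.mem_product.mp (Finset.mem_coe.mp hr)).2)
          (Finset.mem_coe.mpr (Finset.mem_product.mp (Finset.mem_coe.mp hr')).2) h2
        rw [Function.onFun] at h3
        rw [add_vadd, add_vadd]
        rw [Finset.disjoint_left] at h3 ⊢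
        intro y hy hy'
        obtain ⟨u, hu, rfl⟩ := Finset.mem_vadd_finset.mp hy
        exact h3 hu ((Finset.vadd_mem_vadd_finset_iff a).mp hy')
      · left
        simpa using h1
    · intro r x y hxy
      simp only [hZ]
      congr 1
      refine hgU fun l hl => hxy _ ?_
      simp only [Finset.coe_product, Set.mem_prod, Finset.mem_coe, Finset.mem_singleton, true_and]
      exact Finset.mem_vadd_finset.mpr ⟨l, hl, rfl⟩
  have htot : HasSubgaussianMGF (fun x => (I.card : ℝ) * ∑ q : κ × G, Z q x)
      ((Fintype.card G : ℝ≥0) ^ 2 * ((Fintype.card κ * I.card : ℕ) * c)) μ := by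
    have := hasSubgaussianMGF_sum_const (Finset.univ : Finset G) fun a _ => hblock a
    rw [Finset.card_univ] at this
    refine this.congr (Filter.Eventually.of_forall fun x => ?_)
    simp only [Finset.sum_product, Fintype.sum_prod_type]
    rw [Finset.sum_comm, Finset.mul_sum]
    refine Finset.sum_congr rfl fun k _ => ?_
    rw [Finset.sum_comm, ← nsmul_eq_mul, ← Finset.sum_const]
    refine Finset.sum_congr rfl fun i _ => ?_
    exact Fintype.sum_equiv (Equiv.addRight i) _ _ fun a => rfl
  have hIpos : 0 < I.card := by
    rcases Nat.eq_zero_or_pos I.card with h | h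
    · rw [h, zero_mul] at hcard
      exact absurd hcard (not_le.mpr Fintype.card_pos)
    · exact h
  have hexp : Real.exp (-(I.card * ε) ^ 2 / (2 * ((Fintype.card G : ℝ≥0) ^ 2 *
      ((Fintype.card κ * I.card : ℕ) * c) : ℝ≥0))) ≤
      Real.exp (-ε ^ 2 / (2 * (Fintype.card κ * Fintype.card G * D * b ^ 2))) := by
    rw [Real.exp_le_exp]
    push_cast
    rw [hbc, neg_div, neg_div, neg_le_neg_iff]
    have hG : (0 : ℝ) < Fintype.card G := by exact_mod_cast Fintype.card_pos
    have hI' : (0 : ℝ) < I.card := by exact_mod_cast hIpos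
    have hD' : (0 : ℝ) < D := by exact_mod_cast hD
    have hcard' : (Fintype.card G : ℝ) ≤ I.card * D := by exact_mod_cast hcard
    rcases Nat.eq_zero_or_pos (Fintype.card κ) with h0 | h0
    · simp [h0]
    have hκ : (0 : ℝ) < Fintype.card κ := by exact_mod_cast h0
    rw [div_le_div_iff₀ (by positivity) (by positivity)]
    have : 0 ≤ 2 * ε ^ 2 * I.card * Fintype.card G * Fintype.card κ * b ^ 2 := by positivity
    nlinarith [mul_le_mul_of_nonneg_left hcard' this]
  have hI' : (0 : ℝ) < I.card := by exact_mod_cast hIpos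
  have hpos := (htot.measure_ge_le (ε := I.card * ε) (by positivity)).trans hexp
  have hneg := (htot.neg.measure_ge_le (ε := I.card * ε) (by positivity)).trans hexp
  refine (measureReal_mono (s₂ := {x | I.card * ε ≤ I.card * ∑ q : κ × G, Z q x} ∪
    {x | I.card * ε ≤ (-fun x => (I.card : ℝ) * ∑ q : κ × G, Z q x) x}) ?_).trans
    ((measureReal_union_le _ _).trans (by linarith))
  intro x hx
  have hx' : ε ≤ |∑ q : κ × G, Z q x| := hx
  rcases le_abs.mp hx' with h | h
  · exact Or.inl (mul_le_mul_of_nonneg_left h hI'.le)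
  · refine Or.inr ?_
    change (I.card : ℝ) * ε ≤ -(I.card * ∑ q : κ × G, Z q x)
    have := mul_le_mul_of_nonneg_left h hI'.le
    linarith

end Concentration

/-! ### The tensorized Legendre system under the uniform distribution -/

section Tensor

variable {n p : ℕ}

/-- The uniform distribution on `[-1, 1]`. -/
def uniformLaw : Measure ℝ := ProbabilityTheory.cond volume (Set.Icc (-1 : ℝ) 1)

instance : IsProbabilityMeasure uniformLaw :=
  cond_isProbabilityMeasure_of_finite (by simp) (by simp)

lemma ae_uniformLaw_mem : ∀ᵐ y ∂uniformLaw, y ∈ Set.Icc (-1 : ℝ) 1 :=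
  ae_cond_mem measurableSet_Icc

lemma integral_uniformLaw (f : ℝ → ℝ) :
    ∫ y, f y ∂uniformLaw = 1 / 2 * ∫ y in (-1 : ℝ)..1, f y := by
  rw [uniformLaw, ProbabilityTheory.cond, integral_smul_measure,
    intervalIntegral.integral_of_le (by norm_num), ← integral_Icc_eq_integral_Ioc]
  norm_num [Real.volume_Icc]

lemma continuous_tensorLegendre (α : MultiIndex n p) : Continuous (tensorLegendre α) := by
  unfold tensorLegendre
  fun_prop

lemma abs_tensorLegendre_le (α : MultiIndex n p) {z : Fin n → ℝ}
    (hz : ∀ i, z i ∈ Set.Icc (-1 : ℝ) 1) : |tensorLegendre α z| ≤ √3 ^ p := by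
  rw [tensorLegendre, Finset.abs_prod]
  refine (Finset.prod_le_prod (fun _ _ => abs_nonneg _)
    fun i _ => abs_legendre_le _ (hz i)).trans ?_
  rw [Finset.prod_pow_eq_pow_sum]
  exact pow_le_pow_right₀ (Real.one_le_sqrt.mpr (by norm_num)) α.2

lemma abs_tensorLegendre_mul_le (α β : MultiIndex n p) {z : Fin n → ℝ}
    (hz : ∀ i, z i ∈ Set.Icc (-1 : ℝ) 1) :
    |tensorLegendre α z * tensorLegendre β z| ≤ 3 ^ p := by
  rw [abs_mul]
  refine (mul_le_mul (abs_tensorLegendre_le α hz) (abs_tensorLegendre_le β hz) (abs_nonneg _)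
    (by positivity)).trans_eq ?_
  rw [← mul_pow, Real.mul_self_sqrt (by norm_num)]

/-- The coordinates on which a basis function depends. -/
def MultiIndex.support (α : MultiIndex n p) : Finset (Fin n) :=
  Finset.univ.filter fun i => (α.1 i : ℕ) ≠ 0

lemma MultiIndex.card_support_le (α : MultiIndex n p) : α.support.card ≤ p := by
  refine le_trans ?_ α.2
  rw [Finset.card_eq_sum_ones, MultiIndex.support, Finset.sum_filter]
  refine Finset.sum_le_sum fun i _ => ?_
  split_ifs with h
  · exact Nat.one_le_iff_ne_zero.mpr h
  · exact Nat.zero_le _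

lemma dependsOn_tensorLegendre (α : MultiIndex n p) :
    DependsOn (tensorLegendre α) (α.support : Set (Fin n)) := by
  intro x y hxy
  refine Finset.prod_congr rfl fun i _ => ?_
  by_cases hi : (α.1 i : ℕ) = 0
  · rw [hi, legendre_zero, legendre_zero]
  · rw [hxy i (Finset.mem_coe.mpr (Finset.mem_filter.mpr ⟨Finset.mem_univ _, hi⟩))]

lemma dependsOn_tensorLegendre_mul (α β : MultiIndex n p) :
    DependsOn (fun z => tensorLegendre α z * tensorLegendre β z)
      ((α.support ∪ β.support : Finset (Fin n)) : Set (Fin n)) := by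
  intro x y hxy
  simp only
  rw [dependsOn_tensorLegendre α fun i hi => hxy i (by simp_all),
    dependsOn_tensorLegendre β fun i hi => hxy i (by simp_all)]

lemma card_support_union_sq_le (α β : MultiIndex n p) :
    (α.support ∪ β.support).card ^ 2 ≤ 4 * p ^ 2 := by
  have h : (α.support ∪ β.support).card ≤ 2 * p := by
    have := Finset.card_union_le α.support β.support
    have := α.card_support_le
    have := β.card_support_le
    omega
  calc _ ≤ (2 * p) ^ 2 := Nat.pow_le_pow_left h 2
    _ = _ := by ring

/-- Orthonormality of the tensorized Legendre system, evaluated at a shift of a sample. -/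
lemma integral_tensorLegendre_shift_mul {κ : Type*} [Fintype κ] [NeZero n]
    (α β : MultiIndex n p) (k : κ) (j : Fin n) :
    ∫ x : κ × Fin n → ℝ, tensorLegendre α (fun l => x (k, j + l)) *
      tensorLegendre β (fun l => x (k, j + l)) ∂(Measure.pi fun _ => uniformLaw) =
      if α = β then 1 else 0 := by
  set μ := Measure.pi fun _ : κ × Fin n => uniformLaw
  have hi : iIndepFun (fun (q : κ × Fin n) (x : κ × Fin n → ℝ) => x q) μ :=
    iIndepFun_pi (X := fun _ y => y) fun _ => aemeasurable_id
  have hinj : Function.Injective fun l : Fin n => (k, j + l) := by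
    intro l l' h
    exact add_left_cancel (Prod.ext_iff.mp h).2
  have h1 := (hi.precomp hinj).integral_fun_prod_comp
    (f := fun i y => legendre (α.1 i : ℕ) y * legendre (β.1 i : ℕ) y)
    (fun i => (measurable_pi_apply _).aemeasurable)
    (fun i => (by fun_prop : Continuous _).aestronglyMeasurable)
  simp only [tensorLegendre, ← Finset.prod_mul_distrib]
  rw [h1]
  have h2 : ∀ i : Fin n, ∫ x : κ × Fin n → ℝ, legendre (α.1 i : ℕ) (x (k, j + i)) *
      legendre (β.1 i : ℕ) (x (k, j + i)) ∂μ = if α.1 i = β.1 i then 1 else 0 := by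
    intro i
    have h3 := measurePreserving_eval (fun _ : κ × Fin n => uniformLaw) (k, j + i)
    have h4 := integral_map (μ := μ) (φ := Function.eval (k, j + i))
      (measurable_pi_apply _).aemeasurable
      (f := fun y => legendre (α.1 i : ℕ) y * legendre (β.1 i : ℕ) y)
      (by fun_prop : Continuous _).aestronglyMeasurable
    rw [h3.map_eq, integral_uniformLaw, integral_legendre_mul] at h4
    refine h4.symm.trans ?_
    by_cases h : α.1 i = β.1 i
    · simp [h]
    · simp [h, Fin.val_inj]
  rw [Finset.prod_congr rfl fun i _ => h2 i]
  split_ifs with h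
  · simp [h]
  · obtain ⟨i, hi⟩ : ∃ i, α.1 i ≠ β.1 i := by
      by_contra hcon
      push Not at hcon
      exact h (Subtype.ext (funext hcon))
    exact Finset.prod_eq_zero (Finset.mem_univ i) (by simp [hi])

/-- There are at most as many multi-indices as terms in the expansion of `(1 + ⋯ + 1)^p` with
`n + 1` summands, the extra one absorbing the missing degree. -/
lemma card_multiIndex_le : Fintype.card (MultiIndex n p) ≤ (n + 1) ^ p := by
  classical
  have h := Finset.sum_pow_eq_sum_piAntidiag (Finset.univ : Finset (Option (Fin n)))
    (fun _ => (1 : ℕ)) p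
  simp only [Finset.sum_const, Finset.card_univ, Fintype.card_option, Fintype.card_fin, smul_eq_mul,
    mul_one, one_pow, Finset.prod_const_one] at h
  rw [h]
  refine le_trans ?_ (Finset.card_nsmul_le_sum _ _ 1 fun k _ => Nat.multinomial_pos _ _)
  rw [smul_eq_mul, mul_one, ← Finset.card_univ]
  refine Finset.card_le_card_of_injOn
    (fun α o => o.elim (p - ∑ i, (α.1 i : ℕ)) fun i => (α.1 i : ℕ)) ?_ ?_
  · intro α _
    have := α.2
    simp only [Finset.mem_coe, Finset.mem_piAntidiag, Fintype.sum_option, Option.elim_none,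
      Option.elim_some, Finset.mem_univ, implies_true, and_true]
    omega
  · intro α _ β _ hαβ
    refine Subtype.ext (funext fun i => Fin.ext ?_)
    simpa using congrFun hαβ (some i)

end Tensor

/-! ### Near orthogonality of the dictionary with high probability -/

section NearOrthogonality

/-- The left side is the union bound. By Bernoulli's inequality `(1 + 1/(2p))^(2p) ≥ 2`, so after
taking `2p`-th roots it is enough that `(n + 1) p < e n ^ p`. -/
lemma two_mul_pow_mul_rpow_lt {n p : ℕ} (hn : 2 ≤ n) (hp : 1 ≤ p) :
    2 * ((n : ℝ) + 1) ^ (2 * p) * (n : ℝ) ^ (-(729 / 200 * (p : ℝ) ^ 4)) <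
      (Real.exp 1 / p + Real.exp 1 / (2 * (p : ℝ) ^ 2)) ^ (2 * p) *
        (n : ℝ) ^ (-(2 * (p : ℝ) / 11)) := by
  have hn' : (2 : ℝ) ≤ n := by exact_mod_cast hn
  have hp' : (1 : ℝ) ≤ p := by exact_mod_cast hp
  have hp0 : (0 : ℝ) < p := by linarith
  have he : (2 : ℝ) < Real.exp 1 := by have := Real.exp_one_gt_d9; linarith
  have hbern : (2 : ℝ) ≤ (1 + 1 / (2 * p)) ^ (2 * p) := by
    have := one_add_mul_le_pow (a := 1 / (2 * (p : ℝ))) (by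
      have : 0 ≤ 1 / (2 * (p : ℝ)) := by positivity
      linarith) (2 * p)
    push_cast at this
    rw [mul_one_div_cancel (by positivity)] at this
    linarith
  have hfac : Real.exp 1 / p + Real.exp 1 / (2 * (p : ℝ) ^ 2) =
      (1 + 1 / (2 * p)) * (Real.exp 1 / p) := by
    field_simp
  have hpn : (p : ℝ) * n ≤ n ^ p := by
    obtain ⟨q, rfl⟩ : ∃ q, p = q + 1 := ⟨p - 1, by omega⟩
    rw [pow_succ]
    refine mul_le_mul_of_nonneg_right ?_ (by linarith)
    have h1 : q + 1 ≤ 2 ^ q := Nat.lt_two_pow_self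
    calc ((q + 1 : ℕ) : ℝ) ≤ (2 : ℝ) ^ q := by exact_mod_cast h1
      _ ≤ (n : ℝ) ^ q := pow_le_pow_left₀ (by norm_num) hn' q
  have hbase : (n : ℝ) + 1 < Real.exp 1 / p * n ^ p := by
    rw [div_mul_eq_mul_div, lt_div_iff₀ hp0]
    calc ((n : ℝ) + 1) * p ≤ (2 * n) * p := by nlinarith
      _ = 2 * (p * n) := by ring
      _ < Real.exp 1 * (p * n) := by
        refine mul_lt_mul_of_pos_right he (by positivity)
      _ ≤ _ := mul_le_mul_of_nonneg_left hpn (by positivity)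
  have hpow : ((n : ℝ) + 1) ^ (2 * p) < (Real.exp 1 / p) ^ (2 * p) * (n : ℝ) ^ (2 * (p : ℝ) ^ 2) := by
    have h1 := pow_lt_pow_left₀ hbase (by positivity) (n := 2 * p) (by omega)
    rw [mul_pow, ← pow_mul] at h1
    have h2 : (n : ℝ) ^ (2 * (p : ℝ) ^ 2) = (n : ℝ) ^ (p * (2 * p)) := by
      rw [show 2 * (p : ℝ) ^ 2 = ((p * (2 * p) : ℕ) : ℝ) by push_cast; ring, Real.rpow_natCast]
    rwa [h2]
  have hexp : (n : ℝ) ^ (2 * (p : ℝ) ^ 2) * (n : ℝ) ^ (-(729 / 200 * (p : ℝ) ^ 4)) ≤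
      (n : ℝ) ^ (-(2 * (p : ℝ) / 11)) := by
    rw [← Real.rpow_add (by linarith)]
    refine Real.rpow_le_rpow_of_exponent_le (by linarith) ?_
    have h1 : (p : ℝ) ≤ p ^ 2 := by nlinarith
    have h2 : (p : ℝ) ^ 2 ≤ p ^ 4 := by nlinarith
    linarith
  have hX : (0 : ℝ) < (n : ℝ) ^ (-(729 / 200 * (p : ℝ) ^ 4)) := Real.rpow_pos_of_pos (by linarith) _
  calc 2 * ((n : ℝ) + 1) ^ (2 * p) * (n : ℝ) ^ (-(729 / 200 * (p : ℝ) ^ 4))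
      < 2 * ((Real.exp 1 / p) ^ (2 * p) * (n : ℝ) ^ (2 * (p : ℝ) ^ 2)) *
        (n : ℝ) ^ (-(729 / 200 * (p : ℝ) ^ 4)) := by gcongr
    _ = 2 * (Real.exp 1 / p) ^ (2 * p) *
        ((n : ℝ) ^ (2 * (p : ℝ) ^ 2) * (n : ℝ) ^ (-(729 / 200 * (p : ℝ) ^ 4))) := by ring
    _ ≤ 2 * (Real.exp 1 / p) ^ (2 * p) * (n : ℝ) ^ (-(2 * (p : ℝ) / 11)) := by gcongr
    _ ≤ (1 + 1 / (2 * p)) ^ (2 * p) * (Real.exp 1 / p) ^ (2 * p) *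
        (n : ℝ) ^ (-(2 * (p : ℝ) / 11)) := by gcongr
    _ = _ := by rw [hfac, mul_pow]

/-- The deviation of an entry of the Gram matrix `AᵀA` from its mean, for the states `x`. -/
def gramDeviation {K n p : ℕ} [NeZero n] (α β : MultiIndex n p) (x : Fin K × Fin n → ℝ) : ℝ :=
  ∑ q : Fin K × Fin n, (tensorLegendre α (fun l => x (q.1, q.2 + l)) *
    tensorLegendre β (fun l => x (q.1, q.2 + l)) - if α = β then 1 else 0)

lemma measurable_gramDeviation {K n p : ℕ} [NeZero n] (α β : MultiIndex n p) :
    Measurable (gramDeviation (K := K) α β) := by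
  unfold gramDeviation
  have h : ∀ γ : MultiIndex n p, ∀ q : Fin K × Fin n, Measurable fun x : Fin K × Fin n → ℝ =>
      tensorLegendre γ (fun l => x (q.1, q.2 + l)) := fun γ q =>
    (continuous_tensorLegendre γ).measurable.comp
      (measurable_pi_lambda _ fun l => measurable_pi_apply _)
  exact Finset.measurable_fun_sum _ fun q _ => ((h α q).mul (h β q)).sub_const _

/-- The states for which the dictionary is not nearly orthogonal: some entry of `AᵀA` deviates from
`K n` times the identity by more than `9 K n / (20 s)`. The inequality is multiplied by `s`, which
makes the set empty for `s = 0`. -/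
def badStates (n p s K : ℕ) [NeZero n] : Set (Fin K × Fin n → ℝ) :=
  ⋃ (α : MultiIndex n p) (β : MultiIndex n p),
    {x | 9 / 20 * ((K : ℝ) * n) < s * |gramDeviation α β x|}

lemma measurableSet_badStates (n p s K : ℕ) [NeZero n] : MeasurableSet (badStates n p s K) :=
  MeasurableSet.iUnion fun α => MeasurableSet.iUnion fun β =>
    measurableSet_lt measurable_const ((measurable_gramDeviation α β).abs.const_mul _)

/-- The tail bound for one entry of the Gram matrix: the products of two basis functions are
bounded by `3^p` and depend on at most `2p` coordinates. -/
lemma measureReal_gramDeviation_gt_le {n p s K : ℕ} [NeZero n] (hn : 2 ≤ n) (hp : 1 ≤ p)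
    (hs : s ≠ 0) (hK : (K : ℝ) ≥ 144 * (p : ℝ) ^ 6 * 9 ^ p * (s : ℝ) ^ 2 * Real.log n / n)
    (α β : MultiIndex n p) :
    (Measure.pi fun _ : Fin K × Fin n => uniformLaw).real
      {x | 9 / 20 * ((K : ℝ) * n) < s * |gramDeviation α β x|} ≤
      2 * (n : ℝ) ^ (-(729 / 200 * (p : ℝ) ^ 4)) := by
  have hs' : (0 : ℝ) < s := by exact_mod_cast Nat.pos_of_ne_zero hs
  have hn' : (2 : ℝ) ≤ n := by exact_mod_cast hn
  have hp' : (1 : ℝ) ≤ p := by exact_mod_cast hp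
  have hlog : 0 < Real.log n := Real.log_pos (by linarith)
  have hKn : 144 * (p : ℝ) ^ 6 * 9 ^ p * (s : ℝ) ^ 2 * Real.log n ≤ K * n :=
    (div_le_iff₀ (by linarith)).mp hK
  have hKn0 : (0 : ℝ) < K * n := lt_of_lt_of_le (by positivity) hKn
  have htail := measureReal_abs_sum_shift_ge_le (κ := Fin K) (G := Fin n) uniformLaw
    ae_uniformLaw_mem (g := fun z => tensorLegendre α z * tensorLegendre β z)
    ((continuous_tensorLegendre α).mul (continuous_tensorLegendre β)).measurable
    (dependsOn_tensorLegendre_mul α β) (b := 3 ^ p) (by positivity)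
    (fun z hz => abs_tensorLegendre_mul_le α β hz)
    (fun k j => integral_tensorLegendre_shift_mul α β k j) (D := 4 * p ^ 2)
    (Nat.one_le_iff_ne_zero.mpr (by positivity)) (card_support_union_sq_le α β)
    (ε := 9 / 20 * (K * n) / s) (by positivity)
  refine (measureReal_mono ?_).trans (htail.trans ?_)
  · intro x hx
    have hx' : 9 / 20 * ((K : ℝ) * n) < s * |gramDeviation α β x| := hx
    change 9 / 20 * ((K : ℝ) * n) / s ≤ |gramDeviation α β x|
    rw [div_le_iff₀ hs', mul_comm _ (s : ℝ)]
    exact hx'.le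
  · rw [Real.rpow_def_of_pos (by linarith)]
    refine mul_le_mul_of_nonneg_left (Real.exp_le_exp.mpr ?_) (by norm_num)
    have h9 : ((3 : ℝ) ^ p) ^ 2 = 9 ^ p := by rw [← pow_mul, mul_comm, pow_mul]; norm_num
    rw [neg_div, mul_neg, neg_le_neg_iff, le_div_iff₀ (by simp; positivity), h9]
    simp only [Fintype.card_fin]
    push_cast
    -- `729 / 200 = (9 / 20)² * 144 / (2 * 4)`, where `4` comes from the `4 p²` dependent shifts
    have h1 : (9 / 20 * ((K : ℝ) * n) / s) ^ 2 = 81 / 400 * (K * n) * ((K * n) / s ^ 2) := by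
      field_simp
      ring
    rw [h1]
    have h2 : 144 * (p : ℝ) ^ 6 * 9 ^ p * Real.log n ≤ K * n / s ^ 2 := by
      rw [le_div_iff₀ (by positivity)]
      linarith
    calc Real.log n * (729 / 200 * (p : ℝ) ^ 4) * (2 * (K * n * (4 * (p : ℝ) ^ 2) * 9 ^ p))
        = 81 / 400 * (K * n) * (144 * (p : ℝ) ^ 6 * 9 ^ p * Real.log n) := by ring
      _ ≤ _ := mul_le_mul_of_nonneg_left h2 (by positivity)

lemma measureReal_badStates_lt {n p s K : ℕ} [NeZero n] (hn : 2 ≤ n) (hp : 1 ≤ p)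
    (hK : (K : ℝ) ≥ 144 * (p : ℝ) ^ 6 * 9 ^ p * (s : ℝ) ^ 2 * Real.log n / n) :
    (Measure.pi fun _ : Fin K × Fin n => uniformLaw).real (badStates n p s K) <
      (Real.exp 1 / p + Real.exp 1 / (2 * (p : ℝ) ^ 2)) ^ (2 * p) *
        (n : ℝ) ^ (-(2 * (p : ℝ) / 11)) := by
  refine lt_of_le_of_lt ?_ (two_mul_pow_mul_rpow_lt hn hp)
  have hX : (0 : ℝ) ≤ (n : ℝ) ^ (-(729 / 200 * (p : ℝ) ^ 4)) := Real.rpow_nonneg (by positivity) _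
  rcases eq_or_ne s 0 with rfl | hs
  · have : badStates n p 0 K = ∅ := by
      refine Set.eq_empty_of_forall_notMem fun x hx => ?_
      simp only [badStates, Set.mem_iUnion] at hx
      obtain ⟨α, β, hx⟩ := hx
      have hx' : 9 / 20 * ((K : ℝ) * n) < (0 : ℕ) * |gramDeviation α β x| := hx
      have : (0 : ℝ) ≤ 9 / 20 * ((K : ℝ) * n) := by positivity
      simp only [Nat.cast_zero, zero_mul] at hx'
      linarith
    rw [this, measureReal_empty]
    positivity
  · set N := Fintype.card (MultiIndex n p) with hN
    have hcard : (N : ℝ) ≤ ((n : ℝ) + 1) ^ p := by exact_mod_cast card_multiIndex_le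
    calc _ ≤ ∑ α : MultiIndex n p, ∑ β : MultiIndex n p,
          (Measure.pi fun _ : Fin K × Fin n => uniformLaw).real
            {x | 9 / 20 * ((K : ℝ) * n) < s * |gramDeviation α β x|} :=
          (measureReal_iUnion_fintype_le _).trans
            (Finset.sum_le_sum fun α _ => measureReal_iUnion_fintype_le _)
      _ ≤ ∑ _α : MultiIndex n p, ∑ _β : MultiIndex n p,
          2 * (n : ℝ) ^ (-(729 / 200 * (p : ℝ) ^ 4)) :=
          Finset.sum_le_sum fun α _ => Finset.sum_le_sum fun β _ =>
            measureReal_gramDeviation_gt_le hn hp hs hK α β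
      _ = 2 * (N : ℝ) ^ 2 * (n : ℝ) ^ (-(729 / 200 * (p : ℝ) ^ 4)) := by
          simp only [Finset.sum_const, Finset.card_univ, nsmul_eq_mul, ← hN]
          ring
      _ ≤ 2 * ((n : ℝ) + 1) ^ (2 * p) * (n : ℝ) ^ (-(729 / 200 * (p : ℝ) ^ 4)) := by
          rw [mul_comm 2 p, pow_mul]
          gcongr

end NearOrthogonality

/-! ### Recovery of the governing equation -/

section Recovery

variable {n p : ℕ}

lemma velocity_eq {f : (Fin n → ℝ) → Fin n → ℝ} {t₀ T : ℝ} {u : ℝ → Fin n → ℝ}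
    (hu : IsSolutionOn f t₀ T u) {τ : ℝ} (h0 : t₀ ≤ τ) (hT : τ < T) :
    velocity t₀ u τ = f (u τ) :=
  (hu τ ⟨h0, hT⟩).derivWithin (uniqueDiffOn_Ici t₀ τ h0)

/-- A root mean square error `η` of the velocities of the `K` samples is an `ℓ²` error
`√K η` of the stacked velocity vector. -/
lemma l2Norm_stack_le {K : ℕ} (w : Fin K → Fin n → ℝ) {η : ℝ}
    (h : √(1 / (K : ℝ) * ∑ k, l2Norm (w k) ^ 2) ≤ η) :
    l2Norm (fun r : Fin K × Fin n => w r.1 r.2) ≤ √K * η := by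
  rcases Nat.eq_zero_or_pos K with rfl | hK
  · simp [l2Norm]
  have hK' : (0 : ℝ) < K := by exact_mod_cast hK
  refine le_trans (le_of_eq ?_) (mul_le_mul_of_nonneg_left h (Real.sqrt_nonneg _))
  rw [← Real.sqrt_mul hK'.le, ← mul_assoc, mul_one_div_cancel hK'.ne', one_mul, l2Norm,
    Fintype.sum_prod_type]
  simp only [l2Norm_sq]

variable [NeZero n]

lemma sum_dictionary_mul_sub {K : ℕ} (x : Fin K → Fin n → ℝ) (α β : MultiIndex n p) :
    ∑ r, dictionary p x r α * dictionary p x r β - (if α = β then (K : ℝ) * n else 0) =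
      gramDeviation α β (fun q : Fin K × Fin n => x q.1 q.2) := by
  have h : ∀ (q : Fin K × Fin n) (γ : MultiIndex n p), dictionary p x q γ =
      tensorLegendre γ (fun l => x q.1 (q.2 + l)) := fun _ _ => rfl
  simp only [gramDeviation, Finset.sum_sub_distrib, h]
  congr 1
  split_ifs <;> simp

/-- For states outside the bad set the dictionary is injective on differences of vectors in the
`ℓ¹` descent cone, quantitatively. -/
lemma l1Norm_sub_le_of_notMem_badStates {s K : ℕ} (hKn : s ≠ 0 → 1 ≤ (K : ℝ) * n)
    {x : Fin K → Fin n → ℝ}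
    (hx : (fun q : Fin K × Fin n => x q.1 q.2) ∉ badStates n p s K) {c c' : MultiIndex n p → ℝ}
    (hc : IsSparse s c) (hle : l1Norm c' ≤ l1Norm c) :
    l1Norm (c - c') ≤ 30 * s * l2Norm ((dictionary p x).mulVec (c - c')) := by
  refine l1Norm_sub_le_of_nearly_orthogonal _ hKn (fun α β => ?_) hc hle
  rw [sum_dictionary_mul_sub]
  by_contra hcon
  exact hx (Set.mem_iUnion.mpr ⟨α, Set.mem_iUnion.mpr ⟨β, not_le.mp hcon⟩⟩)

/-- By the cyclic condition, the velocities are the image of the coefficients of the first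
component under the dictionary. -/
lemma dictionary_mulVec_eq {Q : Type*} {f : (Fin n → ℝ) → Fin n → ℝ} (hf : IsCyclic f)
    {c : MultiIndex n p → ℝ} (hc : ∀ x, f x 0 = ∑ α, c α * tensorLegendre α x)
    (x : Q → Fin n → ℝ) (r : Q × Fin n) : (dictionary p x).mulVec c r = f (x r.1) r.2 := by
  rw [hf 0 r.2, sub_zero, hc]
  simp only [Matrix.mulVec, dotProduct, dictionary, Matrix.of_apply]
  exact Finset.sum_congr rfl fun α _ => mul_comm _ _

/-- Exact data determine the sparse vector, since already the rows belonging to the initial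
states do. -/
lemma isBPMinimizer_zero_iff {s K m : ℕ} [NeZero m] (hKn : s ≠ 0 → 1 ≤ (K : ℝ) * n)
    {x : Fin K × Fin m → Fin n → ℝ}
    (hx : (fun q : Fin K × Fin n => x (q.1, 0) q.2) ∉ badStates n p s K)
    {c : MultiIndex n p → ℝ} (hc : IsSparse s c) {V : (Fin K × Fin m) × Fin n → ℝ}
    (hV : (dictionary p x).mulVec c = V) (c' : MultiIndex n p → ℝ) :
    IsBPMinimizer (dictionary p x) V 0 c' ↔ c' = c := by
  have huniq : ∀ c', IsFeasible (dictionary p x) V 0 c' → l1Norm c' ≤ l1Norm c → c' = c := by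
    intro c' hfeas hle
    have h0 : (dictionary p x).mulVec (c - c') = 0 := by
      rw [Matrix.mulVec_sub, hV, ← neg_sub, l2Norm_eq_zero hfeas, neg_zero]
    have h1 : (dictionary p fun k => x (k, 0)).mulVec (c - c') = 0 :=
      funext fun r => congrFun h0 ((r.1, 0), r.2)
    have h2 := l1Norm_sub_le_of_notMem_badStates hKn (x := fun k => x (k, 0)) hx hc hle
    rw [h1] at h2
    have h3 : l2Norm (0 : Fin K × Fin n → ℝ) = 0 := by simp [l2Norm]
    rw [h3, mul_zero] at h2
    exact (sub_eq_zero.mp (eq_zero_of_l1Norm_le_zero h2)).symm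
  have hfc : IsFeasible (dictionary p x) V 0 c := by
    simp [IsFeasible, hV, l2Norm]
  refine ⟨fun h => huniq c' h.1 (h.2 c hfc), ?_⟩
  rintro rfl
  refine ⟨hfc, fun c'' h'' => ?_⟩
  by_contra hcon
  rw [huniq c'' h'' (not_le.mp hcon).le] at hcon
  exact hcon le_rfl

lemma l1Norm_sub_le_of_isBPMinimizer {s K : ℕ} (hKn : s ≠ 0 → 1 ≤ (K : ℝ) * n)
    {x : Fin K → Fin n → ℝ}
    (hx : (fun q : Fin K × Fin n => x q.1 q.2) ∉ badStates n p s K)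
    {c : MultiIndex n p → ℝ} (hc : IsSparse s c) {V : Fin K × Fin n → ℝ} {σ : ℝ}
    (hfeas : IsFeasible (dictionary p x) V σ c) {c' : MultiIndex n p → ℝ}
    (hmin : IsBPMinimizer (dictionary p x) V σ c') : l1Norm (c - c') ≤ 60 * s * σ := by
  refine (l1Norm_sub_le_of_notMem_badStates hKn hx hc (hmin.2 c hfeas)).trans ?_
  have h1 : l2Norm ((dictionary p x).mulVec (c - c')) ≤ 2 * σ := by
    rw [Matrix.mulVec_sub, ← sub_sub_sub_cancel_right _ _ V]
    refine (l2Norm_sub_le _ _).trans ?_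
    have := hmin.1
    unfold IsFeasible at this hfeas
    linarith
  calc 30 * (s : ℝ) * l2Norm ((dictionary p x).mulVec (c - c'))
      ≤ 30 * s * (2 * σ) := mul_le_mul_of_nonneg_left h1 (by positivity)
    _ = _ := by ring

end Recovery

end CyclicRecovery

end

open CyclicRecovery in
theorem theorem3p4 :
    ∃ d : ℝ, 0 < d ∧
    ∀ (n p s K m : ℕ) [NeZero n] [NeZero m], 2 ≤ n → 1 ≤ p →
    -- the evolution equation `u' = f(u)`, cyclic, with `s`-sparse Legendre coefficients
    ∀ (f : (Fin n → ℝ) → Fin n → ℝ), IsCyclic f →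
    ∀ (C : Fin n → MultiIndex n p → ℝ),
      (∀ (j : Fin n) (x : Fin n → ℝ), f x j = ∑ α, C j α * tensorLegendre α x) →
      (∀ j : Fin n, IsSparse s (C j)) →
    -- `K` bursts, observed at the times `t 0 < t 1 < ⋯ < t (m - 1)`
    ∀ (t : Fin m → ℝ), StrictMono t →
    ∀ {Ω : Type*} [MeasurableSpace Ω] (P : Measure Ω) [IsProbabilityMeasure P]
      (u : Fin K → Ω → ℝ → Fin n → ℝ),
      (∀ᵐ ω ∂P, ∀ k : Fin K, ∃ T : ℝ, (∀ i, t i < T) ∧ IsSolutionOn f (t 0) T (u k ω)) →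
    -- the components of the initial data are i.i.d. uniform on `[-1, 1]`
      (∀ (k : Fin K) (i : Fin n),
        pdf.IsUniform (fun ω => u k ω (t 0) i) (Set.Icc (-1 : ℝ) 1) P volume) →
      iIndepFun (fun (q : Fin K × Fin n) (ω : Ω) => u q.1 ω (t 0) q.2) P →
    -- the number of bursts
      (K : ℝ) ≥ 144 * (p : ℝ) ^ 6 * 9 ^ p * (s : ℝ) ^ 2 * Real.log n / n →
    ∃ E : Set Ω, MeasurableSet E ∧
      P.real E > 1 - (Real.exp 1 / p + Real.exp 1 / (2 * (p : ℝ) ^ 2)) ^ (2 * p) *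
        (n : ℝ) ^ (-(2 * (p : ℝ) / 11)) ∧
      ∀ ω ∈ E,
        -- exact velocities, all snapshots: exact recovery as the unique solution
        (∀ c' : MultiIndex n p → ℝ,
          IsBPMinimizer
            (dictionary p fun q : Fin K × Fin m => u q.1 ω (t q.2))
            (fun r => velocity (t 0) (u r.1.1 ω) (t r.1.2) r.2) 0 c' ↔ c' = C 0) ∧
        -- velocities at the initial time known up to `η`: stable recovery
        (∀ (η : ℝ) (v : Fin K → Fin n → ℝ),
          Real.sqrt (1 / (K : ℝ) *
            ∑ k, l2Norm (v k - velocity (t 0) (u k ω) (t 0)) ^ 2) ≤ η →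
          (∃ c' : MultiIndex n p → ℝ,
            IsBPMinimizer (dictionary p fun k => u k ω (t 0)) (fun r => v r.1 r.2)
              (Real.sqrt K * η) c') ∧
          ∀ c' : MultiIndex n p → ℝ,
            IsBPMinimizer (dictionary p fun k => u k ω (t 0)) (fun r => v r.1 r.2)
              (Real.sqrt K * η) c' →
            l1Norm (C 0 - c') ≤ d * s * (Real.sqrt K * η)) := by
  refine ⟨60, by norm_num, ?_⟩
  intro n p s K m _ _ hn hp f hf C hfC hC t ht Ω _ P _ u hu hunif hind hK
  have hmap : P.map (fun ω (q : Fin K × Fin n) => u q.1 ω (t 0) q.2) =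
      Measure.pi fun _ : Fin K × Fin n => uniformLaw := by
    have hae : ∀ q : Fin K × Fin n, AEMeasurable (fun ω => u q.1 ω (t 0) q.2) P := fun q =>
      (hunif q.1 q.2).aemeasurable (by simp) (by simp)
    rw [hind.map_fun_eq_pi_map hae]
    congr 1
    funext q
    exact hunif q.1 q.2
  have hX : AEMeasurable (fun ω (q : Fin K × Fin n) => u q.1 ω (t 0) q.2) P :=
    aemeasurable_pi_lambda _ fun q => (hunif q.1 q.2).aemeasurable (by simp) (by simp)
  have hbad := measureReal_badStates_lt (s := s) hn hp hK
  rw [← hmap, map_measureReal_apply_of_aemeasurable hX (measurableSet_badStates n p s K)] at hbad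
  have hKn : s ≠ 0 → 1 ≤ (K : ℝ) * n := by
    intro hs
    have hn' : (2 : ℝ) ≤ n := by exact_mod_cast hn
    have hlog : 0 < Real.log n := Real.log_pos (by linarith)
    have hs' : (0 : ℝ) < s := by exact_mod_cast Nat.pos_of_ne_zero hs
    have hp' : (0 : ℝ) < p := by exact_mod_cast hp
    have hK0 : (0 : ℝ) < K := lt_of_lt_of_le (by positivity) hK
    have hK1 : (1 : ℝ) ≤ K := by exact_mod_cast (Nat.cast_pos.mp hK0 : 0 < K)
    nlinarith
  set B : Set Ω := (fun ω (q : Fin K × Fin n) => u q.1 ω (t 0) q.2) ⁻¹' badStates n p s K with hB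
  set N : Set Ω := {ω | ¬ ∀ k : Fin K, ∃ T : ℝ, (∀ i, t i < T) ∧ IsSolutionOn f (t 0) T (u k ω)}
    with hN
  have hN0 : P.real N = 0 := by
    rw [measureReal_def, show P N = 0 from hu, ENNReal.toReal_zero]
  -- the set `N` need not be measurable, as nothing is assumed about `u` at times after `t 0`
  refine ⟨(toMeasurable P (B ∪ N))ᶜ, (measurableSet_toMeasurable _ _).compl, ?_, ?_⟩
  · rw [probReal_compl_eq_one_sub (measurableSet_toMeasurable _ _)]
    have h1 : P.real (toMeasurable P (B ∪ N)) ≤ P.real B := by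
      rw [measureReal_def, measure_toMeasurable, ← measureReal_def]
      exact (measureReal_union_le _ _).trans (by rw [hN0, add_zero])
    linarith
  · intro ω hω
    have hω' : ω ∉ B ∪ N := fun h => hω (subset_toMeasurable _ _ h)
    have hgood : (fun q : Fin K × Fin n => u q.1 ω (t 0) q.2) ∉ badStates n p s K :=
      fun h => hω' (Or.inl h)
    have hsol : ∀ k : Fin K, ∃ T : ℝ, (∀ i, t i < T) ∧ IsSolutionOn f (t 0) T (u k ω) := by
      by_contra h
      exact hω' (Or.inr h)
    have hvel : ∀ (k : Fin K) (i : Fin m), velocity (t 0) (u k ω) (t i) = f (u k ω (t i)) := by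
      intro k i
      obtain ⟨T, hT, hs⟩ := hsol k
      exact velocity_eq hs (ht.monotone (Fin.zero_le _)) (hT i)
    refine ⟨fun c' => ?_, fun η v hv => ?_⟩
    · refine isBPMinimizer_zero_iff hKn (x := fun q : Fin K × Fin m => u q.1 ω (t q.2)) hgood
        (hC 0) ?_ c'
      funext r
      rw [dictionary_mulVec_eq hf (hfC 0), hvel]
    · have hfeas : IsFeasible (dictionary p fun k => u k ω (t 0)) (fun r => v r.1 r.2)
          (Real.sqrt K * η) (C 0) := by
        rw [IsFeasible, l2Norm_sub_comm]
        refine le_of_eq_of_le (congrArg l2Norm ?_) (l2Norm_stack_le _ hv)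
        funext r
        rw [Pi.sub_apply, dictionary_mulVec_eq hf (hfC 0), Pi.sub_apply, hvel]
      exact ⟨exists_isBPMinimizer _ _ _ hfeas,
        fun c' hc' => l1Norm_sub_le_of_isBPMinimizer hKn hgood (hC 0) hfeas hc'⟩
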